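/- Let $X$ be a Banach space over $\mathbb K\in\{\mathbb R,\mathbb C\}$ with dual $X^*$, let $1\le q<s<\infty$, and define $s(q)'$ by $\frac1{s(q)'}+\frac1s=\frac1q$. For a Banach space $E$ and $0<p<\infty$, let $\ell_p(E)$ be the space of sequences $(a_j)_{j=1}^\infty$ in $E$ with $\|(a_j)\|_p=(\sum_j\|a_j\|^p)^{1/p}<\infty$, and write $\ell_p=\ell_p(\mathbb K)$. Let $\ell_s^w(X)$ be the space of sequences $(y_j)_{j=1}^\infty$ in $X$ with $(x^*(y_j))_j\in\ell_s$ for every $x^*\in X^*$, with norm $\|(y_j)\|_{w,s}=\sup_{\|x^*\|\le1}\|(x^*(y_j))_j\|_s$. Let $\ell_{m(s;q)}(X)$ be the set of sequences $(x_j)_{j=1}^\infty$ in $X$ that can be written as $x_j=\tau_jy_j$ for all $j$, with $(\tau_j)\in\ell_{s(q)'}$ and $(y_j)\in\ell_s^w(X)$, and put $$\|(x_j)\|_{m(s;q)}=\inf\|(\tau_j)\|_{s(q)'}\,\|(y_j)\|_{w,s},$$ the infimum being over all such representations. Let $\ell^A_{(s,q,s)}(X)$ be the set of sequences $(x_j)_{j=1}^\infty$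 in $X$ such that $$\sum_{j=1}^\infty\Big(\sum_{k=1}^\infty|x_k^*(x_j)|^s\Big)^{q/s}<\infty\quad\text{for every }(x_k^*)_{k=1}^\infty\in\ell_s(X^*),$$ and put $$\|(x_j)\|_{A(s,q,s)}=\sup_{\|(x_k^*)\|_s\le1}\Big(\sum_{j=1}^\infty\Big(\sum_{k=1}^\infty|x_k^*(x_j)|^s\Big)^{q/s}\Big)^{1/q}.$$ Then $\ell_{m(s;q)}(X)=\ell^A_{(s,q,s)}(X)$, and for every sequence $(x_j)$ in this space $$\|(x_j)\|_{m(s;q)}=\|(x_j)\|_{A(s,q,s)}<\infty.$$ -/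

import Mathlib

open scoped ENNReal

noncomputable section

namespace MixedSeq

/-- The norm `‖(a_j)‖_p = (∑ ‖a_j‖ ^ p) ^ (1/p)` (for a real exponent `p > 0`),
with the value `⊤` when the series diverges. -/
def ellNorm {E : Type*} [NormedAddCommGroup E] (p : ℝ) (a : ℕ → E) : ℝ≥0∞ :=
  (∑' j, ‖a j‖ₑ ^ p) ^ (1 / p)

/-- Absolutely `p`-summable sequences in `E`, for a real exponent `p > 0`. -/
def ellSpace (E : Type*) [NormedAddCommGroup E] (p : ℝ) : Set (ℕ → E) :=
  {a | Memℓp a (ENNReal.ofReal p)}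

/-- The set of absolutely `p`-summable sequences consists of the sequences of finite norm. -/
theorem mem_ellSpace_iff {E : Type*} [NormedAddCommGroup E] {p : ℝ} (hp : 0 < p) (a : ℕ → E) :
    a ∈ ellSpace E p ↔ ellNorm p a < ⊤ := by
  have h0 : (ENNReal.ofReal p).toReal = p := ENNReal.toReal_ofReal hp.le
  have h1 : a ∈ ellSpace E p ↔ Summable fun j => ‖a j‖ ^ p := by
    have h := memℓp_gen_iff (E := fun _ : ℕ => E) (f := a) (p := ENNReal.ofReal p)
      (by rw [h0]; exact hp)
    rw [h0] at h
    exact h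
  have h2 : ∀ j, ‖a j‖ₑ ^ p = ENNReal.ofReal (‖a j‖ ^ p) := fun j => by
    rw [← ofReal_norm, ENNReal.ofReal_rpow_of_nonneg (norm_nonneg _) hp.le]
  have h3 : ellNorm p a < ⊤ ↔ (∑' j, ‖a j‖ₑ ^ p) ≠ ⊤ := by
    unfold ellNorm
    rw [lt_top_iff_ne_top, ne_eq, ENNReal.rpow_eq_top_iff_of_pos (by positivity)]
  rw [h1, h3]
  simp only [h2]
  constructor
  · intro h
    rw [← ENNReal.ofReal_tsum_of_nonneg (fun j => by positivity) h]
    exact ENNReal.ofReal_ne_top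
  · intro h
    have := ENNReal.summable_toReal h
    refine this.congr fun j => ?_
    rw [ENNReal.toReal_ofReal (by positivity)]

section Spaces

variable (𝕜 : Type*) [RCLike 𝕜] (X : Type*) [NormedAddCommGroup X] [NormedSpace 𝕜 X]

/-- Weakly `p`-summable sequences: those `y` with `(φ (y_j))_j ∈ ℓ_p` for every
continuous linear functional `φ`. -/
def weakSpace (p : ℝ) : Set (ℕ → X) :=
  {y | ∀ φ : StrongDual 𝕜 X, (fun j => φ (y j)) ∈ ellSpace 𝕜 p}

variable {X} in
/-- `‖y‖_{w,p}`, the supremum of `‖(φ (y_j))_j‖_p` over the closed unit ball of the dual. -/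
def weakNorm (p : ℝ) (y : ℕ → X) : ℝ≥0∞ :=
  ⨆ (φ : StrongDual 𝕜 X) (_ : ‖φ‖ ≤ 1), ellNorm p (fun j => φ (y j))

/-- The exponent `s(q)'` determined by `1 / s(q)' + 1 / s = 1 / q`, for `0 < q < s < ∞`. -/
def mixedExponent (s q : ℝ) : ℝ := (1 / q - 1 / s)⁻¹

theorem mixedExponent_spec {s q : ℝ} (hq : 0 < q) (hqs : q < s) :
    0 < mixedExponent s q ∧ 1 / mixedExponent s q + 1 / s = 1 / q := by
  refine ⟨inv_pos.mpr (sub_pos.mpr (one_div_lt_one_div_of_lt hq hqs)), ?_⟩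
  simp [mixedExponent]

variable {X} in
/-- `(τ, y)` is a representation `x_j = τ_j y_j` of `x` with `τ ∈ ℓ_{s(q)'}` and
`y ∈ ℓ_s^w(X)`. -/
def IsMixedRepr (s q : ℝ) (x : ℕ → X) (τ : ℕ → 𝕜) (y : ℕ → X) : Prop :=
  τ ∈ ellSpace 𝕜 (mixedExponent s q) ∧ y ∈ weakSpace 𝕜 X s ∧ ∀ j, x j = τ j • y j

/-- The space `ℓ_{m(s;q)}(X)` of mixed `(s;q)`-summable sequences. -/
def mixedSpace (s q : ℝ) : Set (ℕ → X) :=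
  {x | ∃ (τ : ℕ → 𝕜) (y : ℕ → X), IsMixedRepr 𝕜 s q x τ y}

variable {X} in
/-- `‖x‖_{m(s;q)}`, the infimum of `‖τ‖_{s(q)'} ‖y‖_{w,s}` over all representations. -/
def mixedNorm (s q : ℝ) (x : ℕ → X) : ℝ≥0∞ :=
  ⨅ (τ : ℕ → 𝕜) (y : ℕ → X) (_ : IsMixedRepr 𝕜 s q x τ y),
    ellNorm (mixedExponent s q) τ * weakNorm 𝕜 s y

/-- The space `ℓ^A_{(s,q,r)}(X)` of anisotropic `(s,q,r)`-summable sequences. -/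
def anisotropicSpace (s q r : ℝ) : Set (ℕ → X) :=
  {x | ∀ φ ∈ ellSpace (StrongDual 𝕜 X) r,
    ∑' j, (∑' k, ‖φ k (x j)‖ₑ ^ s) ^ (q / s) < ⊤}

variable {X} in
/-- `‖x‖_{A(s,q,r)}`, the supremum over the closed unit ball of `ℓ_r(X^*)`. -/
def anisotropicNorm (s q r : ℝ) (x : ℕ → X) : ℝ≥0∞ :=
  ⨆ (φ : ℕ → StrongDual 𝕜 X) (_ : φ ∈ ellSpace (StrongDual 𝕜 X) r) (_ : ellNorm r φ ≤ 1),
    (∑' j, (∑' k, ‖φ k (x j)‖ₑ ^ s) ^ (q / s)) ^ (1 / q)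

end Spaces

end MixedSeq

end

open scoped ENNReal

namespace MixedSeq

/-! Write `r` for `s(q)'`. A representation `x = τ y` bounds the anisotropic norm by Hölder with the
conjugate exponents `r / q` and `s / q`, after interchanging the sums over `j` and `k`. The bound is
finite because the weak norm of `y` is finite, by Baire (`weakNorm_lt_top`).

The converse is a domination argument of Pietsch–Maurey type. If the anisotropic norm is at most `C
> 0`, each sequence `φ` of functionals gives a pair `a_j = ∑ |φ_k (x_j)| ^ s`, `b = C ^ s * ∑ ‖φ_k‖
^ s` with `‖a‖_θ ≤ b`, where `θ = q / s < 1`. With `σ = s / r`, so that `θ (1 + σ) = 1`, the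
quasi-norm `‖a‖_θ` is the minimum of `∑ a_j t_j ^ (-σ)` over weights `t ≥ 0` of total mass at most
`1`. Hence each pair has its own weight with `∑ a_j t_j ^ (-σ) ≤ b`. The pairs form a convex set
(`convex_functionalPairs`), the weights form a compact convex set, and the sum is convex in `t` and
linear in `a`, so a minimax theorem yields one weight for all pairs (`exists_common_weight`). Put
`τ_j = t_j ^ (1 / r)` and `y_j = x_j / τ_j`: testing against single functionals gives weak norm at
most `C`. -/

theorem ellNorm_lt_top_iff {E : Type*} [NormedAddCommGroup E] {p : ℝ} (hp : 0 < p) {a : ℕ → E} :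
    ellNorm p a < ⊤ ↔ ∑' j, ‖a j‖ₑ ^ p < ⊤ := by
  unfold ellNorm
  rw [lt_top_iff_ne_top, lt_top_iff_ne_top, ne_eq, ENNReal.rpow_eq_top_iff_of_pos (by positivity)]

theorem mem_ellSpace_iff_tsum {E : Type*} [NormedAddCommGroup E] {p : ℝ} (hp : 0 < p)
    {a : ℕ → E} : a ∈ ellSpace E p ↔ ∑' j, ‖a j‖ₑ ^ p < ⊤ :=
  (mem_ellSpace_iff hp a).trans (ellNorm_lt_top_iff hp)

theorem ellNorm_rpow {E : Type*} [NormedAddCommGroup E] {p : ℝ} (hp : 0 < p) (a : ℕ → E) :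
    ellNorm p a ^ p = ∑' j, ‖a j‖ₑ ^ p := by
  unfold ellNorm
  rw [← ENNReal.rpow_mul, one_div_mul_cancel hp.ne', ENNReal.rpow_one]

/-- Hölder's inequality for series of extended nonnegative reals. -/
theorem tsum_mul_le_Lp_mul_Lq {ι : Type*} (f g : ι → ℝ≥0∞) {p q : ℝ}
    (hpq : p.HolderConjugate q) :
    ∑' i, f i * g i ≤ (∑' i, f i ^ p) ^ (1 / p) * (∑' i, g i ^ q) ^ (1 / q) := by
  rw [ENNReal.tsum_eq_iSup_sum]
  refine iSup_le fun S => (ENNReal.inner_le_Lp_mul_Lq S f g hpq).trans ?_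
  have hp := hpq.nonneg
  have hq := hpq.symm.nonneg
  gcongr <;> exact ENNReal.sum_le_tsum S

/-! ### Weak and anisotropic norms: finiteness, homogeneity, Hölder. -/

section

variable {𝕜 : Type*} [RCLike 𝕜] {X : Type*} [NormedAddCommGroup X] [NormedSpace 𝕜 X]

/-- Makes the sublevel sets closed, as Baire requires. -/
theorem lowerSemicontinuous_tsum_enorm_apply {s : ℝ} (y : ℕ → X) :
    LowerSemicontinuous fun φ : StrongDual 𝕜 X => ∑' j, ‖φ (y j)‖ₑ ^ s := by
  refine lowerSemicontinuous_tsum fun j => Continuous.lowerSemicontinuous ?_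
  have : Continuous fun φ : StrongDual 𝕜 X => φ (y j) := by fun_prop
  exact (ENNReal.continuous_rpow_const).comp this.enorm

/-- The weak norm of a weakly `s`-summable sequence is finite, by the Baire category theorem. -/
theorem weakNorm_lt_top {s : ℝ} (hs : 1 ≤ s) {y : ℕ → X} (hy : y ∈ weakSpace 𝕜 X s) :
    weakNorm 𝕜 s y < ⊤ := by
  have hs0 : 0 < s := by linarith
  set N : StrongDual 𝕜 X → ℝ≥0∞ := fun φ => ∑' j, ‖φ (y j)‖ₑ ^ s with hN
  have hfin : ∀ φ, N φ < ⊤ := fun φ => (mem_ellSpace_iff_tsum hs0).1 (hy φ)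
  have hclosed : ∀ n : ℕ, IsClosed {φ | N φ ≤ n} := fun n =>
    (lowerSemicontinuous_tsum_enorm_apply y).isClosed_preimage n
  have hcover : ⋃ n : ℕ, {φ | N φ ≤ n} = Set.univ := by
    refine Set.eq_univ_of_forall fun φ => Set.mem_iUnion.2 ?_
    obtain ⟨n, hn⟩ := ENNReal.exists_nat_gt (hfin φ).ne
    exact ⟨n, hn.le⟩
  obtain ⟨n, φ₀, hφ₀⟩ := nonempty_interior_of_iUnion_of_closed hclosed hcover
  obtain ⟨ε, hε, hball⟩ := Metric.isOpen_iff.1 isOpen_interior φ₀ hφ₀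
  have hle : ∀ φ ∈ Metric.ball φ₀ ε, N φ ≤ n := fun φ hφ =>
    (interior_subset (hball hφ) : φ ∈ {φ | N φ ≤ n})
  have hadd : ∀ φ ψ, N (φ - ψ) ≤ 2 ^ (s - 1) * (N φ + N ψ) := by
    intro φ ψ
    rw [hN, ← ENNReal.tsum_add, ← ENNReal.tsum_mul_left]
    refine ENNReal.tsum_le_tsum fun j => ?_
    refine le_trans ?_ (ENNReal.rpow_add_le_mul_rpow_add_rpow _ _ hs)
    gcongr
    exact enorm_sub_le
  have hsmul : ∀ (c : 𝕜) φ, N (c • φ) = ‖c‖ₑ ^ s * N φ := by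
    intro c φ
    rw [hN, ← ENNReal.tsum_mul_left]
    refine tsum_congr fun j => ?_
    rw [smul_apply, enorm_smul, ENNReal.mul_rpow_of_nonneg _ _ hs0.le]
  -- The factor `ε / 2` keeps `φ₀ + c • φ` in the ball for all `‖φ‖ ≤ 1`; subtracting `φ₀` then
  -- bounds `N` on the unit ball.
  set c : 𝕜 := ((ε / 2 : ℝ) : 𝕜) with hc
  have hcn : ‖c‖ = ε / 2 := by
    rw [hc, RCLike.norm_ofReal, abs_of_pos (by positivity)]
  have hc0 : c ≠ 0 := by
    rw [← norm_pos_iff, hcn]; positivity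
  set M : ℝ≥0∞ := ‖c⁻¹‖ₑ ^ s * (2 ^ (s - 1) * (n + n)) with hM
  have hMtop : M < ⊤ := by
    refine ENNReal.mul_lt_top (ENNReal.rpow_lt_top_of_nonneg hs0.le enorm_ne_top) ?_
    refine ENNReal.mul_lt_top (ENNReal.rpow_lt_top_of_nonneg (by linarith) (by simp)) ?_
    exact ENNReal.add_lt_top.2 ⟨ENNReal.natCast_lt_top n, ENNReal.natCast_lt_top n⟩
  have hbound : ∀ φ : StrongDual 𝕜 X, ‖φ‖ ≤ 1 → N φ ≤ M := by
    intro φ hφ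
    have hmem : φ₀ + c • φ ∈ Metric.ball φ₀ ε := by
      rw [mem_ball_iff_norm, add_sub_cancel_left, norm_smul, hcn]
      nlinarith [norm_nonneg φ]
    have h : φ = c⁻¹ • ((φ₀ + c • φ) - φ₀) := by
      rw [add_sub_cancel_left, smul_smul, inv_mul_cancel₀ hc0, one_smul]
    rw [h, hsmul, hM]
    gcongr
    refine (hadd _ _).trans ?_
    gcongr
    · exact hle _ hmem
    · exact hle _ (Metric.mem_ball_self hε)
  refine lt_of_le_of_lt (iSup₂_le fun φ hφ => ?_)
    (ENNReal.rpow_lt_top_of_nonneg (y := 1 / s) (by positivity) hMtop.ne)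
  exact ENNReal.rpow_le_rpow (hbound φ hφ) (by positivity)

theorem tsum_enorm_apply_le {s : ℝ} (hs : 0 < s) (y : ℕ → X) (φ : StrongDual 𝕜 X) :
    ∑' j, ‖φ (y j)‖ₑ ^ s ≤ weakNorm 𝕜 s y ^ s * ‖φ‖ₑ ^ s := by
  rcases eq_or_ne φ 0 with rfl | hφ
  · simp [hs]
  have hn : ‖φ‖ ≠ 0 := norm_ne_zero_iff.2 hφ
  set c : 𝕜 := (‖φ‖ : 𝕜) with hc
  have hcφ : ‖c‖ₑ = ‖φ‖ₑ := by
    rw [← ofReal_norm, ← ofReal_norm, hc, RCLike.norm_ofReal, abs_of_nonneg (norm_nonneg _)]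
  have hc0 : c ≠ 0 := by rw [hc]; exact_mod_cast hn
  have hunit : ‖c⁻¹ • φ‖ ≤ 1 := by
    rw [norm_smul, norm_inv, hc, RCLike.norm_ofReal, abs_of_nonneg (norm_nonneg _),
      inv_mul_cancel₀ hn]
  have h1 : ellNorm s (fun j => (c⁻¹ • φ) (y j)) ≤ weakNorm 𝕜 s y :=
    le_iSup₂ (f := fun (φ : StrongDual 𝕜 X) (_ : ‖φ‖ ≤ 1) => ellNorm s (fun j => φ (y j))) _ hunit
  have h2 := ENNReal.rpow_le_rpow h1 hs.le
  rw [ellNorm_rpow hs] at h2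
  calc ∑' j, ‖φ (y j)‖ₑ ^ s = (∑' j, ‖(c⁻¹ • φ) (y j)‖ₑ ^ s) * ‖φ‖ₑ ^ s := by
        rw [← ENNReal.tsum_mul_right]
        refine tsum_congr fun j => ?_
        rw [← ENNReal.mul_rpow_of_nonneg _ _ hs.le, ← hcφ, mul_comm, ← enorm_smul,
          smul_apply, smul_smul, mul_inv_cancel₀ hc0, one_smul]
    _ ≤ _ := by gcongr

/-- The series defining the anisotropic norm, without the outer root. -/
noncomputable def anisotropicSum (s q : ℝ) (x : ℕ → X) (φ : ℕ → StrongDual 𝕜 X) : ℝ≥0∞ :=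
  ∑' j, (∑' k, ‖φ k (x j)‖ₑ ^ s) ^ (q / s)

theorem anisotropicSum_smul {s q : ℝ} (hs : 0 < s) (hq : 0 < q) (x : ℕ → X) (c : 𝕜)
    (φ : ℕ → StrongDual 𝕜 X) :
    anisotropicSum s q x (fun k => c • φ k) = ‖c‖ₑ ^ q * anisotropicSum s q x φ := by
  unfold anisotropicSum
  rw [← ENNReal.tsum_mul_left]
  refine tsum_congr fun j => ?_
  have : ∀ k, ‖(c • φ k) (x j)‖ₑ ^ s = ‖c‖ₑ ^ s * ‖φ k (x j)‖ₑ ^ s := fun k => by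
    rw [smul_apply, enorm_smul, ENNReal.mul_rpow_of_nonneg _ _ hs.le]
  simp_rw [this]
  rw [ENNReal.tsum_mul_left, ENNReal.mul_rpow_of_nonneg _ _ (by positivity), ← ENNReal.rpow_mul,
    mul_div_cancel₀ _ hs.ne']

theorem tsum_enorm_smul {s : ℝ} (hs : 0 < s) (c : 𝕜) (φ : ℕ → StrongDual 𝕜 X) :
    ∑' k, ‖c • φ k‖ₑ ^ s = ‖c‖ₑ ^ s * ∑' k, ‖φ k‖ₑ ^ s := by
  rw [← ENNReal.tsum_mul_left]
  refine tsum_congr fun j => ?_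
  rw [enorm_smul, ENNReal.mul_rpow_of_nonneg _ _ hs.le]

/-- Hölder splits off `‖τ‖_r ^ q`; in the other factor the `j`-sum is taken first, for fixed `k`,
where the weak norm of `y` controls it. -/
theorem anisotropicSum_le_of_isMixedRepr {s q : ℝ} (hq : 0 < q) (hqs : q < s) {x : ℕ → X}
    {τ : ℕ → 𝕜} {y : ℕ → X} (h : IsMixedRepr 𝕜 s q x τ y) (φ : ℕ → StrongDual 𝕜 X) :
    anisotropicSum s q x φ ≤ (ellNorm (mixedExponent s q) τ * weakNorm 𝕜 s y) ^ q *
      (∑' k, ‖φ k‖ₑ ^ s) ^ (q / s) := by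
  have hs : 0 < s := hq.trans hqs
  obtain ⟨hr, hrs⟩ := mixedExponent_spec hq hqs
  set r := mixedExponent s q with hr_def
  have hconj : (r / q).HolderConjugate (s / q) := by
    have e : (r / q)⁻¹ + (s / q)⁻¹ = 1 := by
      have : (r / q)⁻¹ + (s / q)⁻¹ = q * (1 / r + 1 / s) := by field_simp
      rw [this, hrs]; field_simp
    refine Real.holderConjugate_iff.2 ⟨?_, e⟩
    have h1 : (r / q)⁻¹ < 1 := by
      have : 0 < (s / q)⁻¹ := by positivity
      linarith
    exact (inv_lt_one₀ (by positivity)).1 h1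
  have hterm : ∀ j, (∑' k, ‖φ k (x j)‖ₑ ^ s) ^ (q / s) =
      ‖τ j‖ₑ ^ q * (∑' k, ‖φ k (y j)‖ₑ ^ s) ^ (q / s) := by
    intro j
    have : ∀ k, ‖φ k (x j)‖ₑ ^ s = ‖τ j‖ₑ ^ s * ‖φ k (y j)‖ₑ ^ s := fun k => by
      rw [h.2.2 j, map_smul, enorm_smul, ENNReal.mul_rpow_of_nonneg _ _ hs.le]
    simp_rw [this]
    rw [ENNReal.tsum_mul_left, ENNReal.mul_rpow_of_nonneg _ _ (by positivity), ← ENNReal.rpow_mul,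
      mul_div_cancel₀ _ hs.ne']
  unfold anisotropicSum
  simp_rw [hterm]
  refine (tsum_mul_le_Lp_mul_Lq _ _ hconj).trans ?_
  have e1 : ∀ j, (‖τ j‖ₑ ^ q) ^ (r / q) = ‖τ j‖ₑ ^ r := fun j => by
    rw [← ENNReal.rpow_mul, mul_div_cancel₀ _ hq.ne']
  have e2 : ∀ j, ((∑' k, ‖φ k (y j)‖ₑ ^ s) ^ (q / s)) ^ (s / q) = ∑' k, ‖φ k (y j)‖ₑ ^ s :=
    fun j => by
      rw [← ENNReal.rpow_mul, show q / s * (s / q) = 1 by field_simp, ENNReal.rpow_one]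
  simp_rw [e1, e2]
  rw [← ellNorm_rpow hr, ← ENNReal.rpow_mul, ENNReal.mul_rpow_of_nonneg _ _ hq.le,
    show r * (1 / (r / q)) = q by field_simp, mul_assoc, ENNReal.tsum_comm, one_div_div]
  gcongr
  have e3 : weakNorm 𝕜 s y ^ q = (weakNorm 𝕜 s y ^ s) ^ (q / s) := by
    rw [← ENNReal.rpow_mul, mul_div_cancel₀ _ hs.ne']
  rw [e3, ← ENNReal.mul_rpow_of_nonneg _ _ (by positivity), ← ENNReal.tsum_mul_left]
  gcongr with k
  exact tsum_enorm_apply_le hs y (φ k)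

theorem anisotropicNorm_le_of_isMixedRepr {s q : ℝ} (hq : 0 < q) (hqs : q < s) {x : ℕ → X}
    {τ : ℕ → 𝕜} {y : ℕ → X} (h : IsMixedRepr 𝕜 s q x τ y) :
    anisotropicNorm 𝕜 s q s x ≤ ellNorm (mixedExponent s q) τ * weakNorm 𝕜 s y := by
  have hs : 0 < s := hq.trans hqs
  refine iSup_le fun φ => iSup₂_le fun _ hφ => ?_
  rw [one_div, ENNReal.rpow_inv_le_iff hq]
  refine (anisotropicSum_le_of_isMixedRepr hq hqs h φ).trans ?_
  have : (∑' k, ‖φ k‖ₑ ^ s) ^ (q / s) ≤ 1 := by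
    rw [← ellNorm_rpow hs]
    exact ENNReal.rpow_le_one (ENNReal.rpow_le_one hφ hs.le) (by positivity)
  exact mul_le_of_le_one_right' this

/-- Homogeneity: normalize `φ` in `ℓ_s`. The zero sequence is treated apart. -/
theorem anisotropicSum_le {s q : ℝ} (hq : 0 < q) (hs : 0 < s) (x : ℕ → X)
    {φ : ℕ → StrongDual 𝕜 X} (hφ : ∑' k, ‖φ k‖ₑ ^ s < ⊤) :
    anisotropicSum s q x φ ≤
      anisotropicNorm 𝕜 s q s x ^ q * (∑' k, ‖φ k‖ₑ ^ s) ^ (q / s) := by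
  set T := ∑' k, ‖φ k‖ₑ ^ s with hT
  rcases eq_or_ne T 0 with h0 | h0
  · have hz : ∀ k, φ k = 0 := fun k => by
      have := ENNReal.tsum_eq_zero.1 h0 k
      rw [ENNReal.rpow_eq_zero_iff_of_pos hs] at this
      rw [← ofReal_norm, ENNReal.ofReal_eq_zero] at this
      exact norm_le_zero_iff.1 this
    have : anisotropicSum s q x φ = 0 := by
      simp [anisotropicSum, hz, hs, div_pos hq hs]
    rw [this]; exact zero_le
  have hTr : 0 < T.toReal := ENNReal.toReal_pos h0 hφ.ne
  set ρ : ℝ := T.toReal ^ (1 / s) with hρ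
  have hρ0 : 0 < ρ := by positivity
  set c : 𝕜 := (ρ : 𝕜) with hc
  have hc0 : c ≠ 0 := by rw [hc]; exact_mod_cast hρ0.ne'
  have hcn : ‖c‖ₑ ^ s = T := by
    rw [← ofReal_norm, hc, RCLike.norm_ofReal, abs_of_pos hρ0, ENNReal.ofReal_rpow_of_pos hρ0, hρ,
      ← Real.rpow_mul hTr.le, one_div_mul_cancel hs.ne', Real.rpow_one, ENNReal.ofReal_toReal hφ.ne]
  have hcq : ‖c‖ₑ ^ q = T ^ (q / s) := by
    rw [← hcn, ← ENNReal.rpow_mul, mul_div_cancel₀ _ hs.ne']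
  have hψ : ∑' k, ‖c⁻¹ • φ k‖ₑ ^ s = 1 := by
    rw [tsum_enorm_smul hs, ← hT, enorm_inv hc0, ENNReal.inv_rpow, hcn,
      ENNReal.inv_mul_cancel h0 hφ.ne]
  have hψ1 : (fun k => c⁻¹ • φ k) ∈ ellSpace (StrongDual 𝕜 X) s := by
    rw [mem_ellSpace_iff_tsum hs, hψ]; exact ENNReal.one_lt_top
  have hψ2 : ellNorm s (fun k => c⁻¹ • φ k) ≤ 1 := by
    rw [ellNorm, hψ, ENNReal.one_rpow]
  have h1 : anisotropicSum s q x (fun k => c⁻¹ • φ k) ^ (1 / q) ≤ anisotropicNorm 𝕜 s q s x :=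
    le_iSup_of_le (fun k => c⁻¹ • φ k) (le_iSup₂_of_le hψ1 hψ2 le_rfl)
  rw [one_div, ENNReal.rpow_inv_le_iff hq] at h1
  have h2 : φ = fun k => c • (fun k => c⁻¹ • φ k) k := by
    funext k
    simp [smul_smul, mul_inv_cancel₀ hc0]
  rw [h2, anisotropicSum_smul hs hq, hcq, mul_comm]
  gcongr

/-- A concatenation of sequences of functionals dominates each of its blocks. -/
theorem anisotropicSum_uncurry_ge {s q : ℝ} (hs : 0 < s) (hq : 0 < q) (x : ℕ → X)
    (φ : ℕ → ℕ → StrongDual 𝕜 X) (e : ℕ ≃ ℕ × ℕ) (n : ℕ) :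
    anisotropicSum s q x (φ n) ≤ anisotropicSum s q x (fun i => φ (e i).1 (e i).2) := by
  unfold anisotropicSum
  refine ENNReal.tsum_le_tsum fun j => ENNReal.rpow_le_rpow ?_ (by positivity)
  rw [e.tsum_eq (fun p : ℕ × ℕ => ‖φ p.1 p.2 (x j)‖ₑ ^ s),
    ENNReal.tsum_prod (f := fun n k => ‖φ n k (x j)‖ₑ ^ s)]
  exact ENNReal.le_tsum (f := fun n => ∑' k, ‖φ n k (x j)‖ₑ ^ s) n

/-- A gliding hump argument: if the norm were infinite, then a sequence that concatenates rescaled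
almost extremal sequences would violate the defining condition. -/
theorem anisotropicNorm_lt_top {s q : ℝ} (hq : 0 < q) (hs : 0 < s) {x : ℕ → X}
    (hx : x ∈ anisotropicSpace 𝕜 X s q s) : anisotropicNorm 𝕜 s q s x < ⊤ := by
  by_contra htop
  rw [not_lt_top_iff] at htop
  -- Since `‖c n‖ ^ s = 2 ^ (-n)`, blocks from the unit ball scaled by `c n` concatenate to an
  -- element of `ℓ_s`; the infinite norm absorbs the loss of `‖c n‖ ^ q`.
  set c : ℕ → 𝕜 := fun n => (((2⁻¹ : ℝ) ^ n) ^ (1 / s) : ℝ) with hc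
  have hpos : ∀ n : ℕ, 0 < ((2⁻¹ : ℝ) ^ n) ^ (1 / s) := fun n => by positivity
  have hc0 : ∀ n, c n ≠ 0 := fun n =>
    RCLike.ofReal_ne_zero.2 (hpos n).ne'
  have hcs : ∀ n, ‖c n‖ₑ ^ s = 2⁻¹ ^ n := fun n => by
    rw [← ofReal_norm, hc, RCLike.norm_ofReal, abs_of_pos (hpos n),
      ENNReal.ofReal_rpow_of_pos (hpos n), ← Real.rpow_mul (by positivity),
      one_div_mul_cancel hs.ne', Real.rpow_one, ENNReal.ofReal_pow (by norm_num),
      ENNReal.ofReal_inv_of_pos (by norm_num)]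
    norm_num
  have hex : ∀ n : ℕ, ∃ φ : ℕ → StrongDual 𝕜 X, ∑' k, ‖φ k‖ₑ ^ s ≤ 1 ∧
      (n : ℝ≥0∞) ≤ ‖c n‖ₑ ^ q * anisotropicSum s q x φ := by
    intro n
    have hcq0 : ‖c n‖ₑ ^ q ≠ 0 := by
      rw [ne_eq, ENNReal.rpow_eq_zero_iff_of_pos hq]; simpa using hc0 n
    have hcqt : ‖c n‖ₑ ^ q ≠ ⊤ := ENNReal.rpow_ne_top_of_nonneg hq.le enorm_ne_top
    have hlt : ((n : ℝ≥0∞) / ‖c n‖ₑ ^ q) ^ (1 / q) < anisotropicNorm 𝕜 s q s x := by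
      rw [htop]
      exact ENNReal.rpow_lt_top_of_nonneg (by positivity)
        (ENNReal.div_ne_top (ENNReal.natCast_ne_top n) hcq0)
    unfold anisotropicNorm at hlt
    obtain ⟨φ, hφ⟩ := lt_iSup_iff.1 hlt
    obtain ⟨_, hφ⟩ := lt_iSup_iff.1 hφ
    obtain ⟨h1, hφ⟩ := lt_iSup_iff.1 hφ
    refine ⟨φ, ?_, ?_⟩
    · rw [← ellNorm_rpow hs]; exact ENNReal.rpow_le_one h1 hs.le
    · have := (ENNReal.rpow_lt_rpow_iff (by positivity)).1 hφ
      rw [mul_comm]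
      exact (ENNReal.div_le_iff hcq0 hcqt).1 this.le
  choose φ hφ1 hφ2 using hex
  set ψ : ℕ → ℕ → StrongDual 𝕜 X := fun n k => c n • φ n k with hψ
  have e : ℕ ≃ ℕ × ℕ := Nat.pairEquiv.symm
  have hmem : (fun i => ψ (e i).1 (e i).2) ∈ ellSpace (StrongDual 𝕜 X) s := by
    rw [mem_ellSpace_iff_tsum hs, e.tsum_eq (fun p : ℕ × ℕ => ‖ψ p.1 p.2‖ₑ ^ s),
      ENNReal.tsum_prod (f := fun n k => ‖ψ n k‖ₑ ^ s)]
    calc ∑' n, ∑' k, ‖ψ n k‖ₑ ^ s ≤ ∑' n : ℕ, (2⁻¹ : ℝ≥0∞) ^ n := by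
          refine ENNReal.tsum_le_tsum fun n => ?_
          rw [hψ, tsum_enorm_smul hs, hcs]
          exact mul_le_of_le_one_right' (hφ1 n)
      _ < ⊤ := by
          rw [ENNReal.tsum_geometric, ENNReal.one_sub_inv_two, inv_inv]; simp
  have hlt : anisotropicSum s q x (fun i => ψ (e i).1 (e i).2) < ⊤ := hx _ hmem
  obtain ⟨n, hn⟩ := ENNReal.exists_nat_gt hlt.ne
  refine absurd hn (not_lt.2 ?_)
  refine (hφ2 n).trans ?_
  rw [← anisotropicSum_smul hs hq]
  exact anisotropicSum_uncurry_ge hs hq x ψ e n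

end

/-! ### A common weight by compactness and minimax. -/

theorem convexOn_rpow_neg {σ : ℝ} (hσ : 0 ≤ σ) :
    ConvexOn ℝ (Set.Ioi 0) fun t : ℝ => t ^ (-σ) := by
  refine ⟨convex_Ioi 0, fun u hu v hv a b ha hb hab => ?_⟩
  have hlog := strictConcaveOn_log_Ioi.concaveOn.2 hu hv ha hb hab
  have hw : (0 : ℝ) < a • u + b • v := convex_Ioi (𝕜 := ℝ) (0 : ℝ) hu hv ha hb hab
  have hexp := convexOn_exp.2 (Set.mem_univ (Real.log u * -σ)) (Set.mem_univ (Real.log v * -σ))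
    ha hb hab
  simp only [smul_eq_mul] at *
  rw [Real.rpow_def_of_pos hw, Real.rpow_def_of_pos hu, Real.rpow_def_of_pos hv]
  -- The power is the exponential of the convex function `-σ * log t`.
  refine le_trans (Real.exp_le_exp.2 ?_) hexp
  nlinarith

/-- Nonnegative sequences with sum at most `1`. -/
def subSimplex : Set (ℕ → ℝ) :=
  {t | (∀ j, 0 ≤ t j) ∧ ∀ n, ∑ j ∈ Finset.range n, t j ≤ 1}

theorem convex_subSimplex : Convex ℝ subSimplex := by
  intro t ht u hu a b ha hb hab
  refine ⟨fun j => ?_, fun n => ?_⟩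
  · have := ht.1 j
    have := hu.1 j
    simp only [Pi.add_apply, Pi.smul_apply, smul_eq_mul]
    positivity
  · simp only [Pi.add_apply, Pi.smul_apply, smul_eq_mul, Finset.sum_add_distrib, ← Finset.mul_sum]
    nlinarith [mul_le_mul_of_nonneg_left (ht.2 n) ha, mul_le_mul_of_nonneg_left (hu.2 n) hb]

/-- Closedness is in the product topology, where mass may escape to infinity; hence total mass at
most `1`, not equal to `1`. -/
theorem isClosed_subSimplex : IsClosed subSimplex := by
  have h : subSimplex = (⋂ j, {t : ℕ → ℝ | 0 ≤ t j}) ∩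
      ⋂ n, {t : ℕ → ℝ | ∑ j ∈ Finset.range n, t j ≤ 1} := by
    ext t
    simp [subSimplex]
  rw [h]
  exact (isClosed_iInter fun j => isClosed_le continuous_const (continuous_apply j)).inter
    (isClosed_iInter fun n => isClosed_le
      (continuous_finsetSum _ fun j _ => continuous_apply j) continuous_const)

theorem isCompact_subSimplex : IsCompact subSimplex := by
  refine (isCompact_univ_pi fun _ : ℕ => isCompact_Icc (a := (0 : ℝ)) (b := 1)).of_isClosed_subset
    isClosed_subSimplex fun t ht j _ => ⟨ht.1 j, ?_⟩
  exact (Finset.single_le_sum (fun i _ => ht.1 i) (Finset.self_mem_range_succ j)).trans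
    (ht.2 (j + 1))

theorem zero_mem_subSimplex : (0 : ℕ → ℝ) ∈ subSimplex := ⟨fun _ => le_rfl, fun n => by simp⟩

/-- The weight `t` regularized by `δ`, tested against the first `n` entries of `a`. -/
noncomputable def weightedSum (σ δ : ℝ) (n : ℕ) (t a : ℕ → ℝ) : ℝ :=
  ∑ j ∈ Finset.range n, a j * (t j + δ) ^ (-σ)

theorem continuousOn_weightedSum {σ δ : ℝ} (hδ : 0 < δ) (n : ℕ) (a : ℕ → ℝ) :
    ContinuousOn (fun t => weightedSum σ δ n t a) subSimplex := by
  refine continuousOn_finsetSum _ fun j _ => continuousOn_const.mul ?_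
  refine ContinuousOn.rpow_const (by fun_prop) fun t ht => Or.inl ?_
  have := ht.1 j
  positivity

theorem convexOn_weightedSum {σ δ : ℝ} (hσ : 0 ≤ σ) (hδ : 0 < δ) (n : ℕ) {a : ℕ → ℝ}
    (ha : ∀ j, 0 ≤ a j) : ConvexOn ℝ subSimplex fun t => weightedSum σ δ n t a := by
  refine ⟨convex_subSimplex, fun t ht u hu c d hc hd hcd => ?_⟩
  simp only [weightedSum, smul_eq_mul, Finset.mul_sum, ← Finset.sum_add_distrib]
  refine Finset.sum_le_sum fun j _ => ?_
  have h1 : t j + δ ∈ Set.Ioi (0 : ℝ) := add_pos_of_nonneg_of_pos (ht.1 j) hδ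
  have h2 : u j + δ ∈ Set.Ioi (0 : ℝ) := add_pos_of_nonneg_of_pos (hu.1 j) hδ
  have h := (convexOn_rpow_neg hσ).2 h1 h2 hc hd hcd
  simp only [smul_eq_mul] at h
  have e : (c • t + d • u) j + δ = c * (t j + δ) + d * (u j + δ) := by
    simp only [Pi.add_apply, Pi.smul_apply, smul_eq_mul]
    linear_combination (-δ) * hcd
  rw [e]
  nlinarith [mul_le_mul_of_nonneg_left h (ha j)]

/-- The optimal weight is `t_j = a_j ^ θ / S`: without `δ` the sum equals `S ^ (1 + σ)`, and `δ > 0`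
only decreases it. -/
theorem exists_weightedSum_le {σ θ δ : ℝ} (hσ : 0 < σ) (hθ : 0 < θ) (hσθ : θ * (1 + σ) = 1)
    (hδ : 0 < δ) (n : ℕ) {a : ℕ → ℝ} {b : ℝ} (ha : ∀ j, 0 ≤ a j) (hb : 0 ≤ b)
    (hab : ∑ j ∈ Finset.range n, a j ^ θ ≤ b ^ θ) :
    ∃ t ∈ subSimplex, weightedSum σ δ n t a ≤ b := by
  set S := ∑ j ∈ Finset.range n, a j ^ θ with hS
  have hS0 : 0 ≤ S := Finset.sum_nonneg fun j _ => Real.rpow_nonneg (ha j) _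
  rcases hS0.eq_or_lt with h0 | hpos
  · refine ⟨0, zero_mem_subSimplex, le_trans (le_of_eq ?_) hb⟩
    refine Finset.sum_eq_zero fun j hj => ?_
    have := (Finset.sum_eq_zero_iff_of_nonneg
      (fun j _ => Real.rpow_nonneg (ha j) θ)).1 h0.symm j hj
    rw [Real.rpow_eq_zero (ha j) hθ.ne'] at this
    rw [this, zero_mul]
  · refine ⟨fun j => if j < n then a j ^ θ / S else 0, ⟨fun j => ?_, fun m => ?_⟩, ?_⟩
    · have := Real.rpow_nonneg (ha j) θ
      dsimp only
      split_ifs <;> positivity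
    · rw [← Finset.sum_filter, ← Finset.sum_div, div_le_one hpos]
      refine Finset.sum_le_sum_of_subset_of_nonneg (fun j hj => ?_)
        fun j _ _ => Real.rpow_nonneg (ha j) _
      exact Finset.mem_range.2 (Finset.mem_filter.1 hj).2
    · calc weightedSum σ δ n (fun j => if j < n then a j ^ θ / S else 0) a
          ≤ ∑ j ∈ Finset.range n, a j ^ θ * S ^ σ := by
            refine Finset.sum_le_sum fun j hj => ?_
            simp only [if_pos (Finset.mem_range.1 hj)]
            rcases (ha j).eq_or_lt with h | h
            · rw [← h, zero_mul]; positivity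
            have hp : 0 < a j ^ θ := Real.rpow_pos_of_pos h _
            calc a j * (a j ^ θ / S + δ) ^ (-σ) ≤ a j * (a j ^ θ / S) ^ (-σ) := by
                  refine mul_le_mul_of_nonneg_left ?_ h.le
                  exact Real.rpow_le_rpow_of_nonpos (by positivity) (by linarith) (by linarith)
              _ = a j ^ θ * S ^ σ := by
                  rw [Real.div_rpow hp.le hpos.le, ← Real.rpow_mul h.le, Real.rpow_neg hpos.le σ,
                    div_inv_eq_mul, ← mul_assoc]
                  congr 1
                  nth_rewrite 1 [← Real.rpow_one (a j)]
                  rw [← Real.rpow_add h]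
                  congr 1
                  linarith
        _ = S ^ (1 + σ) := by
            rw [← Finset.sum_mul, ← hS, Real.rpow_add hpos, Real.rpow_one]
        _ ≤ (b ^ θ) ^ (1 + σ) := Real.rpow_le_rpow hS0 hab (by linarith)
        _ = b := by rw [← Real.rpow_mul hb, hσθ, Real.rpow_one]

/-- If no weight served all pairs, compactness would give finitely many pairs with no common weight,
and Sion's theorem a single pair that defeats every weight, contrary to `exists_weightedSum_le`.
Here `δ > 0` gives continuity where `t_j = 0`. -/
theorem exists_forall_weightedSum_le {σ θ δ : ℝ} (hσ : 0 < σ) (hθ : 0 < θ)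
    (hσθ : θ * (1 + σ) = 1) (hδ : 0 < δ) (n : ℕ) {Y : Set ((ℕ → ℝ) × ℝ)} (hY : Convex ℝ Y)
    (ha : ∀ y ∈ Y, ∀ j, 0 ≤ y.1 j) (hb : ∀ y ∈ Y, 0 ≤ y.2)
    (hab : ∀ y ∈ Y, ∑ j ∈ Finset.range n, y.1 j ^ θ ≤ y.2 ^ θ) :
    ∃ t ∈ subSimplex, ∀ y ∈ Y, weightedSum σ δ n t y.1 ≤ y.2 := by
  set f : (ℕ → ℝ) → (ℕ → ℝ) × ℝ → ℝ := fun t y => weightedSum σ δ n t y.1 - y.2 with hf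
  have hfc : ∀ y, ContinuousOn (fun t => f t y) subSimplex := fun y =>
    (continuousOn_weightedSum hδ n y.1).sub continuousOn_const
  have hfy : ∀ t, Continuous (f t) := fun t => by
    refine Continuous.sub (continuous_finsetSum _ fun j _ => ?_) continuous_snd
    exact ((continuous_apply j).comp continuous_fst).mul continuous_const
  by_contra! hne
  set C : Y → Set (ℕ → ℝ) := fun y => subSimplex ∩ (fun t => f t y) ⁻¹' Set.Iic 0 with hC
  have hCc : ∀ y, IsClosed (C y) := fun y =>
    (hfc y).preimage_isClosed_of_isClosed isClosed_subSimplex isClosed_Iic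
  have hempty : subSimplex ∩ ⋂ y, C y = ∅ := by
    refine Set.eq_empty_of_forall_notMem fun t ht => ?_
    obtain ⟨y, hy, hlt⟩ := hne t ht.1
    have := (Set.mem_iInter.1 ht.2 ⟨y, hy⟩).2
    simp only [hf, Set.mem_preimage, Set.mem_Iic] at this
    linarith
  obtain ⟨u, hu⟩ := isCompact_subSimplex.elim_finite_subfamily_closed C hCc hempty
  obtain ⟨y, hy, hlt⟩ := Sion.exists_lt_iInf_of_lt_iInf_of_finite (X := subSimplex) (Y := Y)
    (f := f) ⟨0, zero_mem_subSimplex⟩ isCompact_subSimplex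
    (fun y _ => (hfc y).lowerSemicontinuousOn)
    (fun y hy => ((convexOn_weightedSum hσ.le hδ n (ha y hy)).sub
      (concaveOn_const _ convex_subSimplex)).quasiconvexOn)
    hY (fun t _ => (hfy t).continuousOn.upperSemicontinuousOn)
    (fun t _ => by
      refine ConcaveOn.quasiconcaveOn ⟨hY, fun y _ z _ c d _ _ _ => le_of_eq ?_⟩
      simp only [hf, weightedSum, Prod.fst_add, Prod.snd_add, Prod.smul_fst, Prod.smul_snd,
        Pi.add_apply, Pi.smul_apply, smul_eq_mul, add_mul, Finset.sum_add_distrib, mul_sub,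
        Finset.mul_sum, mul_assoc]
      ring)
    convex_subSimplex (s := Subtype.val '' (u : Set Y)) (u.finite_toSet.image _)
    (by rintro _ ⟨y, _, rfl⟩; exact y.2) (t := 0)
    (fun t ht => by
      by_contra! h
      have : t ∈ subSimplex ∩ ⋂ y ∈ u, C y :=
        ⟨ht, Set.mem_iInter₂.2 fun y hy => ⟨ht, h y ⟨y, hy, rfl⟩⟩⟩
      rw [hu] at this
      exact this)
  obtain ⟨t, ht, hle⟩ := exists_weightedSum_le hσ hθ hσθ hδ n (ha y hy) (hb y hy) (hab y hy)
  have := hlt t ht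
  simp only [hf] at this
  linarith

/-- A common weight for a convex family of pairs `(a, b)` such that `‖a‖_θ ≤ b`, where `θ < 1`. -/
theorem exists_common_weight {σ θ : ℝ} (hσ : 0 < σ) (hθ : 0 < θ)
    (hσθ : θ * (1 + σ) = 1) {Y : Set ((ℕ → ℝ) × ℝ)} (hY : Convex ℝ Y)
    (ha : ∀ y ∈ Y, ∀ j, 0 ≤ y.1 j) (hb : ∀ y ∈ Y, 0 ≤ y.2)
    (hab : ∀ y ∈ Y, ∀ n, ∑ j ∈ Finset.range n, y.1 j ^ θ ≤ y.2 ^ θ) :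
    ∃ t ∈ subSimplex, ∀ y ∈ Y,
      ∑' j, ENNReal.ofReal (y.1 j) * ENNReal.ofReal (t j) ^ (-σ) ≤ ENNReal.ofReal y.2 := by
  set δ : ℕ → ℝ := fun n => 1 / ((n : ℝ) + 1) with hδ
  have hδ0 : ∀ n, 0 < δ n := fun n => by positivity
  have hδa : ∀ m n, m ≤ n → δ n ≤ δ m := fun m n h => Nat.one_div_le_one_div h
  -- Larger `n` means smaller `δ` and more nonnegative terms, so the compact sets `K n` below
  -- decrease and a weight in their intersection exists.
  have hmono : ∀ m n, m ≤ n → ∀ t ∈ subSimplex, ∀ y ∈ Y, ∀ N ≤ m,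
      weightedSum σ (δ m) N t y.1 ≤ weightedSum σ (δ n) n t y.1 := by
    intro m n h t ht y hy N hN
    have hpos : ∀ j, 0 < t j + δ n := fun j => add_pos_of_nonneg_of_pos (ht.1 j) (hδ0 n)
    calc weightedSum σ (δ m) N t y.1 ≤ weightedSum σ (δ n) N t y.1 := by
          refine Finset.sum_le_sum fun j _ => mul_le_mul_of_nonneg_left ?_ (ha y hy j)
          exact Real.rpow_le_rpow_of_nonpos (hpos j) (by linarith [hδa m n h]) (by linarith)
      _ ≤ _ := by
          refine Finset.sum_le_sum_of_subset_of_nonneg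
            (Finset.range_subset_range.2 (hN.trans h)) fun j _ _ => ?_
          exact mul_nonneg (ha y hy j) (Real.rpow_nonneg (hpos j).le _)
  set K : ℕ → Set (ℕ → ℝ) := fun n =>
    {t | t ∈ subSimplex ∧ ∀ y ∈ Y, weightedSum σ (δ n) n t y.1 ≤ y.2} with hK
  have hKc : ∀ n, IsClosed (K n) := by
    intro n
    have : K n = subSimplex ∩ ⋂ y ∈ Y,
        (subSimplex ∩ (fun t => weightedSum σ (δ n) n t y.1) ⁻¹' Set.Iic y.2) := by
      ext t
      simp only [hK, Set.mem_ofPred_eq, Set.mem_inter_iff, Set.mem_iInter, Set.mem_preimage,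
        Set.mem_Iic]
      exact ⟨fun h => ⟨h.1, fun y hy => ⟨h.1, h.2 y hy⟩⟩, fun h => ⟨h.1, fun y hy => (h.2 y hy).2⟩⟩
    rw [this]
    exact isClosed_subSimplex.inter (isClosed_biInter fun y _ =>
      (continuousOn_weightedSum (hδ0 n) n y.1).preimage_isClosed_of_isClosed isClosed_subSimplex
        isClosed_Iic)
  obtain ⟨t, ht⟩ := IsCompact.nonempty_iInter_of_sequence_nonempty_isCompact_isClosed K
    (fun n t ht => ⟨ht.1, fun y hy =>
      (hmono n (n + 1) n.le_succ t ht.1 y hy n le_rfl).trans (ht.2 y hy)⟩)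
    (fun n => exists_forall_weightedSum_le hσ hθ hσθ (hδ0 n) n hY ha hb fun y hy => hab y hy n)
    (isCompact_subSimplex.of_isClosed_subset (hKc 0) fun t ht => ht.1) hKc
  rw [Set.mem_iInter] at ht
  refine ⟨t, (ht 0).1, fun y hy => ENNReal.tsum_le_of_sum_range_le fun N => ?_⟩
  -- Here `δ → 0` with `N` fixed. In `ℝ≥0∞` the power is continuous even at `0`, where it takes the
  -- value `⊤`.
  have hlim : Filter.Tendsto (fun n => ∑ j ∈ Finset.range N,
      ENNReal.ofReal (y.1 j) * ENNReal.ofReal (t j + δ n) ^ (-σ)) Filter.atTop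
      (nhds (∑ j ∈ Finset.range N, ENNReal.ofReal (y.1 j) * ENNReal.ofReal (t j) ^ (-σ))) := by
    refine tendsto_finsetSum _ fun j _ =>
      ENNReal.Tendsto.const_mul ?_ (Or.inr ENNReal.ofReal_ne_top)
    refine (ENNReal.continuous_rpow_const.tendsto _).comp (ENNReal.tendsto_ofReal ?_)
    simpa [hδ] using (tendsto_const_nhds (x := t j)).add
      (tendsto_one_div_add_atTop_nhds_zero_nat (𝕜 := ℝ))
  refine le_of_tendsto hlim ?_
  filter_upwards [Filter.eventually_ge_atTop N] with n hn
  have hpos : ∀ j, 0 < t j + δ n := fun j => add_pos_of_nonneg_of_pos ((ht 0).1.1 j) (hδ0 n)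
  have heq : ∑ j ∈ Finset.range N, ENNReal.ofReal (y.1 j) * ENNReal.ofReal (t j + δ n) ^ (-σ) =
      ENNReal.ofReal (weightedSum σ (δ n) N t y.1) := by
    rw [weightedSum, ENNReal.ofReal_sum_of_nonneg fun j _ =>
      mul_nonneg (ha y hy j) (Real.rpow_nonneg (hpos j).le _)]
    refine Finset.sum_congr rfl fun j _ => ?_
    rw [ENNReal.ofReal_mul (ha y hy j), ENNReal.ofReal_rpow_of_pos (hpos j)]
  rw [heq]
  exact ENNReal.ofReal_le_ofReal ((hmono n n le_rfl t (ht 0).1 y hy N hn).trans ((ht n).2 y hy))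

/-! ### From a common weight to a factorization. -/

section

variable {𝕜 : Type*} [RCLike 𝕜] {X : Type*} [NormedAddCommGroup X] [NormedSpace 𝕜 X]

theorem enorm_ofReal_rpow_rpow {s a : ℝ} (hs : 0 < s) (ha : 0 ≤ a) :
    ‖((a ^ (1 / s) : ℝ) : 𝕜)‖ₑ ^ s = ENNReal.ofReal a := by
  have h := Real.rpow_nonneg ha (1 / s)
  rw [← ofReal_norm, RCLike.norm_ofReal, abs_of_nonneg h, ENNReal.ofReal_rpow_of_nonneg h hs.le,
    ← Real.rpow_mul ha, one_div_mul_cancel hs.ne', Real.rpow_one]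

/-- The pairs `(a, b)` with `a_j = ∑ |φ_k (x_j)| ^ s` and `b ≥ C ^ s * ∑ ‖φ_k‖ ^ s` for some
sequence `φ` of functionals. -/
def functionalPairs (𝕜 : Type*) [RCLike 𝕜] {X : Type*} [NormedAddCommGroup X] [NormedSpace 𝕜 X]
    (s C : ℝ) (x : ℕ → X) : Set ((ℕ → ℝ) × ℝ) :=
  {p | (∀ j, 0 ≤ p.1 j) ∧ 0 ≤ p.2 ∧ ∃ φ : ℕ → StrongDual 𝕜 X,
    (∀ j, ENNReal.ofReal (p.1 j) = ∑' k, ‖φ k (x j)‖ₑ ^ s) ∧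
    ENNReal.ofReal C ^ s * ∑' k, ‖φ k‖ₑ ^ s ≤ ENNReal.ofReal p.2}

/-- Scale the two sequences of functionals by `a ^ (1 / s)` and `b ^ (1 / s)` and interleave them:
sums of `s`-th powers add. -/
theorem convex_functionalPairs {s : ℝ} (hs : 0 < s) (C : ℝ) (x : ℕ → X) :
    Convex ℝ (functionalPairs 𝕜 s C x) := by
  rintro p ⟨hp1, hp2, φ, hφ1, hφ2⟩ p' ⟨hp1', hp2', ψ, hψ1, hψ2⟩ a b ha hb -
  refine ⟨fun j => ?_, ?_, ?_⟩
  · have := hp1 j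
    have := hp1' j
    simp only [Prod.fst_add, Prod.smul_fst, Pi.add_apply, Pi.smul_apply, smul_eq_mul]
    positivity
  · simp only [Prod.snd_add, Prod.smul_snd, smul_eq_mul]
    positivity
  set c : 𝕜 := ((a ^ (1 / s) : ℝ) : 𝕜)
  set d : 𝕜 := ((b ^ (1 / s) : ℝ) : 𝕜)
  have hc : ‖c‖ₑ ^ s = ENNReal.ofReal a := enorm_ofReal_rpow_rpow hs ha
  have hd : ‖d‖ₑ ^ s = ENNReal.ofReal b := enorm_ofReal_rpow_rpow hs hb
  set χ : ℕ ⊕ ℕ → StrongDual 𝕜 X := Sum.elim (fun k => c • φ k) (fun k => d • ψ k) with hχ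
  set e : ℕ ≃ ℕ ⊕ ℕ := Equiv.natSumNatEquivNat.symm
  refine ⟨fun i => χ (e i), fun j => ?_, ?_⟩
  · rw [e.tsum_eq (fun i => ‖χ i (x j)‖ₑ ^ s),
      ENNReal.summable.tsum_sum ENNReal.summable]
    simp only [hχ, Sum.elim_inl, Sum.elim_inr, smul_apply, enorm_smul,
      ENNReal.mul_rpow_of_nonneg _ _ hs.le, ENNReal.tsum_mul_left, hc, hd, ← hφ1, ← hψ1]
    simp only [Prod.fst_add, Prod.smul_fst, Pi.add_apply, Pi.smul_apply, smul_eq_mul]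
    rw [ENNReal.ofReal_add (mul_nonneg ha (hp1 j)) (mul_nonneg hb (hp1' j)),
      ENNReal.ofReal_mul ha, ENNReal.ofReal_mul hb]
  · rw [e.tsum_eq (fun i => ‖χ i‖ₑ ^ s), ENNReal.summable.tsum_sum ENNReal.summable]
    simp only [hχ, Sum.elim_inl, Sum.elim_inr, tsum_enorm_smul hs, hc, hd]
    simp only [Prod.snd_add, Prod.smul_snd, smul_eq_mul]
    rw [ENNReal.ofReal_add (mul_nonneg ha hp2) (mul_nonneg hb hp2'),
      ENNReal.ofReal_mul ha, ENNReal.ofReal_mul hb, mul_add, mul_left_comm,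
      mul_left_comm _ (ENNReal.ofReal b)]
    gcongr

theorem sum_rpow_le_of_mem_functionalPairs {s q C : ℝ} (hq : 0 < q) (hs : 0 < s) (hC : 0 < C)
    {x : ℕ → X} (hx : anisotropicNorm 𝕜 s q s x ≤ ENNReal.ofReal C) {p : (ℕ → ℝ) × ℝ}
    (hp : p ∈ functionalPairs 𝕜 s C x) (n : ℕ) :
    ∑ j ∈ Finset.range n, p.1 j ^ (q / s) ≤ p.2 ^ (q / s) := by
  obtain ⟨hp1, hp2, φ, hφ1, hφ2⟩ := hp
  have hθ : 0 ≤ q / s := by positivity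
  -- As `C > 0`, an infinite sum would contradict the real bound `p.2`.
  have hfin : ∑' k, ‖φ k‖ₑ ^ s < ⊤ := by
    rw [lt_top_iff_ne_top]
    intro h
    have h0 : ENNReal.ofReal C ^ s ≠ 0 := by
      simp [ENNReal.rpow_eq_zero_iff, hC, hs.not_gt]
    rw [h, ENNReal.mul_top h0] at hφ2
    exact ENNReal.ofReal_ne_top (top_le_iff.1 hφ2)
  rw [← ENNReal.ofReal_le_ofReal_iff (Real.rpow_nonneg hp2 _),
    ENNReal.ofReal_sum_of_nonneg fun j _ => Real.rpow_nonneg (hp1 j) _,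
    ← ENNReal.ofReal_rpow_of_nonneg hp2 hθ]
  calc ∑ j ∈ Finset.range n, ENNReal.ofReal (p.1 j ^ (q / s))
      = ∑ j ∈ Finset.range n, (∑' k, ‖φ k (x j)‖ₑ ^ s) ^ (q / s) := by
        refine Finset.sum_congr rfl fun j _ => ?_
        rw [← hφ1, ENNReal.ofReal_rpow_of_nonneg (hp1 j) hθ]
    _ ≤ anisotropicSum s q x φ := ENNReal.sum_le_tsum _
    _ ≤ anisotropicNorm 𝕜 s q s x ^ q * (∑' k, ‖φ k‖ₑ ^ s) ^ (q / s) :=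
        anisotropicSum_le hq hs x hfin
    _ ≤ ENNReal.ofReal C ^ q * (∑' k, ‖φ k‖ₑ ^ s) ^ (q / s) := by gcongr
    _ = (ENNReal.ofReal C ^ s * ∑' k, ‖φ k‖ₑ ^ s) ^ (q / s) := by
        rw [ENNReal.mul_rpow_of_nonneg _ _ hθ, ← ENNReal.rpow_mul, mul_div_cancel₀ _ hs.ne']
    _ ≤ ENNReal.ofReal p.2 ^ (q / s) := by gcongr

/-- The sequence `φ, 0, 0, …`; it turns the common weight into a weak norm estimate. -/
theorem mem_functionalPairs_single {s C : ℝ} (hs : 0 < s) (hC : 0 < C) (x : ℕ → X)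
    (φ : StrongDual 𝕜 X) :
    ((fun j => ‖φ (x j)‖ ^ s), C ^ s * ‖φ‖ ^ s) ∈ functionalPairs 𝕜 s C x := by
  refine ⟨fun j => by positivity, by positivity, fun k => if k = 0 then φ else 0, fun j => ?_, ?_⟩
  · rw [tsum_eq_single 0 fun k hk => by simp [hk, hs]]
    simp only [if_true]
    rw [← ofReal_norm, ENNReal.ofReal_rpow_of_nonneg (norm_nonneg _) hs.le]
  · rw [tsum_eq_single 0 fun k hk => by simp [hk, hs, ← ofReal_norm]]
    simp only [if_true]
    rw [← ofReal_norm, ENNReal.ofReal_rpow_of_nonneg (norm_nonneg _) hs.le,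
      ENNReal.ofReal_rpow_of_pos hC, ← ENNReal.ofReal_mul (by positivity)]

/-- A sequence of anisotropic norm at most `C` is the product of a sequence in the unit ball of
`ℓ_{s(q)'}` and a sequence of weak norm at most `C`. -/
theorem exists_isMixedRepr_of_anisotropicNorm_le {s q C : ℝ} (hq : 0 < q) (hqs : q < s)
    (hC : 0 < C) {x : ℕ → X} (hx : anisotropicNorm 𝕜 s q s x ≤ ENNReal.ofReal C) :
    ∃ (τ : ℕ → 𝕜) (y : ℕ → X), IsMixedRepr 𝕜 s q x τ y ∧ ellNorm (mixedExponent s q) τ ≤ 1 ∧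
      weakNorm 𝕜 s y ≤ ENNReal.ofReal C := by
  have hs : 0 < s := hq.trans hqs
  obtain ⟨hr, hrs⟩ := mixedExponent_spec hq hqs
  set r := mixedExponent s q
  have hσ : 0 < s / r := by positivity
  have hσθ : q / s * (1 + s / r) = 1 := by
    have : q / s * (1 + s / r) = q * (1 / r + 1 / s) := by field_simp; ring
    rw [this, hrs]; field_simp
  obtain ⟨t, ht, hle⟩ := exists_common_weight hσ (div_pos hq hs) hσθ
    (convex_functionalPairs hs C x) (fun p hp => hp.1) (fun p hp => hp.2.1)
    (fun p hp => sum_rpow_le_of_mem_functionalPairs hq hs hC hx hp)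
  have hφle : ∀ φ : StrongDual 𝕜 X, ∑' j, ‖φ (x j)‖ₑ ^ s * ENNReal.ofReal (t j) ^ (-(s / r)) ≤
      ENNReal.ofReal C ^ s * ‖φ‖ₑ ^ s := by
    intro φ
    have h := hle _ (mem_functionalPairs_single hs hC x φ)
    rw [ENNReal.ofReal_mul (by positivity), ← ENNReal.ofReal_rpow_of_pos hC,
      ← ENNReal.ofReal_rpow_of_nonneg (norm_nonneg _) hs.le, ofReal_norm] at h
    refine le_trans (le_of_eq (tsum_congr fun j => ?_)) h
    rw [← ENNReal.ofReal_rpow_of_nonneg (norm_nonneg _) hs.le, ofReal_norm]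
  have hfin : ∀ φ : StrongDual 𝕜 X, ENNReal.ofReal C ^ s * ‖φ‖ₑ ^ s < ⊤ := fun φ =>
    ENNReal.mul_lt_top (ENNReal.rpow_lt_top_of_nonneg hs.le ENNReal.ofReal_ne_top)
      (ENNReal.rpow_lt_top_of_nonneg hs.le enorm_ne_top)
  -- Where the weight vanishes, `0 ^ (-σ) = ⊤` forces every functional to vanish at `x j`, so
  -- dividing by `τ j = 0` later is harmless.
  have hzero : ∀ j, t j = 0 → x j = 0 := by
    intro j hj
    refine SeparatingDual.eq_zero_of_forall_dual_eq_zero (R := 𝕜) fun φ => ?_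
    by_contra hne
    have h := (ENNReal.le_tsum j).trans (hφle φ)
    rw [hj, ENNReal.ofReal_zero, ENNReal.zero_rpow_of_neg (by linarith), ENNReal.mul_top] at h
    · exact (hfin φ).ne (top_le_iff.1 h)
    · rw [ne_eq, ENNReal.rpow_eq_zero_iff_of_pos hs]; simpa using hne
  -- The exponent `1 / r` gives both `∑ |τ_j| ^ r = ∑ t_j ≤ 1` and `|τ_j| ^ (-s) = t_j ^ (-σ)` where
  -- `t_j ≠ 0`.
  set τ : ℕ → 𝕜 := fun j => ((t j ^ (1 / r) : ℝ) : 𝕜) with hτ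
  have hτr : ∀ j, ‖τ j‖ₑ ^ r = ENNReal.ofReal (t j) := fun j =>
    enorm_ofReal_rpow_rpow hr (ht.1 j)
  have hτ0 : ∀ j, t j ≠ 0 → τ j ≠ 0 := fun j hj =>
    RCLike.ofReal_ne_zero.2 ((Real.rpow_ne_zero (ht.1 j) (by positivity)).2 hj)
  have hτsum : ∑' j, ‖τ j‖ₑ ^ r ≤ 1 := by
    simp_rw [hτr]
    refine ENNReal.tsum_le_of_sum_range_le fun n => ?_
    rw [← ENNReal.ofReal_sum_of_nonneg fun j _ => ht.1 j]
    exact ENNReal.ofReal_le_one.2 (ht.2 n)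
  have hy : ∀ φ : StrongDual 𝕜 X, ∑' j, ‖φ ((τ j)⁻¹ • x j)‖ₑ ^ s ≤
      ENNReal.ofReal C ^ s * ‖φ‖ₑ ^ s := by
    intro φ
    refine le_trans (ENNReal.tsum_le_tsum fun j => ?_) (hφle φ)
    rcases eq_or_ne (t j) 0 with h0 | h0
    · simp [hzero j h0, hs]
    · rw [map_smul, enorm_smul, enorm_inv (hτ0 j h0), ENNReal.mul_rpow_of_nonneg _ _ hs.le,
        ← hτr, ← ENNReal.rpow_mul, ENNReal.inv_rpow, ← ENNReal.rpow_neg, mul_comm,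
        show r * -(s / r) = -s by field_simp]
  refine ⟨τ, fun j => (τ j)⁻¹ • x j, ⟨?_, fun φ => ?_, fun j => ?_⟩, ?_, iSup₂_le fun φ hφ => ?_⟩
  · exact (mem_ellSpace_iff_tsum hr).2 (hτsum.trans_lt ENNReal.one_lt_top)
  · exact (mem_ellSpace_iff_tsum hs).2 ((hy φ).trans_lt (hfin φ))
  · rcases eq_or_ne (t j) 0 with h0 | h0
    · simp [hzero j h0]
    · rw [smul_smul, mul_inv_cancel₀ (hτ0 j h0), one_smul]
  · exact ENNReal.rpow_le_one hτsum (by positivity)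
  · have hφ1 : ‖φ‖ₑ ≤ 1 := by
      rw [← ofReal_norm]; exact ENNReal.ofReal_le_one.2 hφ
    rw [ellNorm, one_div, ENNReal.rpow_inv_le_iff hs]
    exact (hy φ).trans (mul_le_of_le_one_right' (ENNReal.rpow_le_one hφ1 hs.le))

/-- The factorization needs `C > 0` while the norm may be `0`, hence the `ε`. -/
theorem mixedNorm_le_anisotropicNorm {s q : ℝ} (hq : 0 < q) (hqs : q < s) (x : ℕ → X) :
    mixedNorm 𝕜 s q x ≤ anisotropicNorm 𝕜 s q s x := by
  refine ENNReal.le_of_forall_pos_le_add fun ε hε hfin => ?_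
  set C : ℝ := (anisotropicNorm 𝕜 s q s x).toReal + ε with hC
  have hCe : ENNReal.ofReal C = anisotropicNorm 𝕜 s q s x + ε := by
    rw [hC, ENNReal.ofReal_add ENNReal.toReal_nonneg ε.coe_nonneg, ENNReal.ofReal_toReal hfin.ne,
      ENNReal.ofReal_coe_nnreal]
  have hC0 : 0 < C := add_pos_of_nonneg_of_pos ENNReal.toReal_nonneg (by exact_mod_cast hε)
  obtain ⟨τ, y, h, hτ, hy⟩ := exists_isMixedRepr_of_anisotropicNorm_le (𝕜 := 𝕜) hq hqs hC0
    (x := x) (by rw [hCe]; exact le_self_add)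
  refine (iInf_le_of_le τ (iInf₂_le y h)).trans ?_
  rw [← hCe]
  calc _ ≤ 1 * ENNReal.ofReal C := by gcongr
    _ = _ := one_mul _

end

end MixedSeq

/-! ### Equality of the spaces and of the norms. -/

theorem theorem2p8 {𝕜 : Type*} [RCLike 𝕜] {X : Type*} [NormedAddCommGroup X]
    [NormedSpace 𝕜 X] [CompleteSpace X] {s q : ℝ} (hq : 1 ≤ q) (hqs : q < s) :
    MixedSeq.mixedSpace 𝕜 X s q = MixedSeq.anisotropicSpace 𝕜 X s q s ∧
    ∀ x ∈ MixedSeq.mixedSpace 𝕜 X s q,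
      MixedSeq.mixedNorm 𝕜 s q x = MixedSeq.anisotropicNorm 𝕜 s q s x ∧
      MixedSeq.anisotropicNorm 𝕜 s q s x < ⊤ := by
  have hq0 : 0 < q := by linarith
  have hs : 0 < s := hq0.trans hqs
  have hr := (MixedSeq.mixedExponent_spec hq0 hqs).1
  have hrepr : ∀ {x : ℕ → X} {τ : ℕ → 𝕜} {y : ℕ → X}, MixedSeq.IsMixedRepr 𝕜 s q x τ y →
      MixedSeq.ellNorm (MixedSeq.mixedExponent s q) τ * MixedSeq.weakNorm 𝕜 s y < ⊤ :=
    fun h => ENNReal.mul_lt_top ((MixedSeq.mem_ellSpace_iff hr _).1 h.1)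
      (MixedSeq.weakNorm_lt_top (hq.trans hqs.le) h.2.1)
  refine ⟨Set.Subset.antisymm ?_ ?_, ?_⟩
  · rintro x ⟨τ, y, h⟩ φ hφ
    refine (MixedSeq.anisotropicSum_le_of_isMixedRepr hq0 hqs h φ).trans_lt ?_
    refine ENNReal.mul_lt_top (ENNReal.rpow_lt_top_of_nonneg hq0.le (hrepr h).ne) ?_
    exact ENNReal.rpow_lt_top_of_nonneg (by positivity)
      ((MixedSeq.mem_ellSpace_iff_tsum hs).1 hφ).ne
  · intro x hx
    have hfin := MixedSeq.anisotropicNorm_lt_top hq0 hs hx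
    obtain ⟨τ, y, h, -⟩ := MixedSeq.exists_isMixedRepr_of_anisotropicNorm_le (𝕜 := 𝕜) (x := x)
      (C := (MixedSeq.anisotropicNorm 𝕜 s q s x).toReal + 1) hq0 hqs (by positivity)
      (ENNReal.le_ofReal_iff_toReal_le hfin.ne (by positivity) |>.2 (by linarith))
    exact ⟨τ, y, h⟩
  · rintro x ⟨τ, y, h⟩
    refine ⟨le_antisymm (MixedSeq.mixedNorm_le_anisotropicNorm hq0 hqs x) ?_,
      (MixedSeq.anisotropicNorm_le_of_isMixedRepr hq0 hqs h).trans_lt (hrepr h)⟩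
    exact le_iInf fun τ => le_iInf₂ fun y h => MixedSeq.anisotropicNorm_le_of_isMixedRepr hq0 hqs h
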